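/- Let $G$ be a finite-dimensional real Lie group with Lie algebra $\mathfrak g=T_eG$ and a left-invariant Riemannian metric $h$, and let $A=h_e:\mathfrak g\to\mathfrak g^*$ be its inertia operator. The geodesic system of $h$, written in the left trivialization of $T^*G$, is $$L_{g^{-1}*}\dot g=\omega,\qquad m_c=A\omega,\qquad \dot m_c=\mathrm{ad}^*_{\omega}m_c,$$ where $(\mathrm{ad}^*_\omega m)(\xi)=m([\omega,\xi])$. For a trajectory put $m=h_g(\dot g,\cdot)\in T_g^*G$, and let $m_s=R_g^*m\in\mathfrak g^*$ be its momentum in space. A vector field $v$ on $G$ is called *reduced* at the level $m_s\in\mathfrak g^*$ if its (local) integral curves are exactly the projections to $G$ of the (local) trajectories whose momentum in space is identically $m_s$; $v$ is *reduced* if it is so for some $m_s$. The reduced fields are the stationary flows with constant pressure defined by $h$. Precisely: 1. The reduced fields form a linear subspace $S$ of the space of vector fields on $G$. 2. Every $v\in S$ is the velocity of a stationary flow of an ideal fluid on $(G,h)$ with constant pressure: $v$ is smooth, $\nabla_v v=-\operatorname{grad}p$ with $p$ constant, where $\nabla$ is the Levi-Civita connection of $h$, and $v$ is divergence free with respect to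 every right Haar measure $\mu$ on $G$, i.e. $\int_G df(v)\,d\mu=0$ for all $f\in C_c^\infty(G)$. 3. The map $v\mapsto m$, $m(g)=h_g(v(g),\cdot)$, is a linear isomorphism from $S$ onto the space of right-invariant covector fields on $G$, i.e. those with $R_a^*m=m$ for all $a\in G$. -/

import Mathlib

open Bundle Filter MeasureTheory
open scoped Manifold ContDiff Topology

noncomputable section

namespace IdealFlow

section Definitions

variable {E : Type*} [NormedAddCommGroup E] [NormedSpace ℝ E]
  {H : Type*} [TopologicalSpace H] (I : ModelWithCorners ℝ E H)
  {G : Type*} [TopologicalSpace G] [ChartedSpace H G]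

/-- The type of (not necessarily continuous) vector fields on `G`. -/
abbrev VectorFields (G : Type*) [TopologicalSpace G] [ChartedSpace H G] : Type _ :=
  (g : G) → TangentSpace I g

/-- The type of (not necessarily continuous) covector fields on `G`. -/
abbrev CovectorFields (G : Type*) [TopologicalSpace G] [ChartedSpace H G] : Type _ :=
  (g : G) → TangentSpace I g →L[ℝ] ℝ

section Fluid

variable [IsManifold I 1 G]
  (h : ContMDiffRiemannianMetric I ∞ E (fun g : G => TangentSpace I g))
  (conn : CovariantDerivative I E (fun g : G => TangentSpace I g))

/-- `conn` is the Levi-Civita connection of the Riemannian metric `h`: it is torsion free,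
`∇_X Y - ∇_Y X = [X, Y]`, and compatible with `h`, `d(h(X, Y))(u) = h(∇_u X, Y) + h(X, ∇_u Y)`.
Mathlib's argument order is `conn Y x (X x) = (∇_X Y)(x)`. -/
structure IsLeviCivita : Prop where
  torsion_free : ∀ (X Y : VectorFields I G) (x : G),
    MDifferentiableAt I I.tangent (fun y => (⟨y, X y⟩ : TangentBundle I G)) x →
    MDifferentiableAt I I.tangent (fun y => (⟨y, Y y⟩ : TangentBundle I G)) x →
    conn Y x (X x) - conn X x (Y x) = VectorField.mlieBracket I X Y x
  metric : ∀ (X Y : VectorFields I G) (x : G) (u : TangentSpace I x),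
    MDifferentiableAt I I.tangent (fun y => (⟨y, X y⟩ : TangentBundle I G)) x →
    MDifferentiableAt I I.tangent (fun y => (⟨y, Y y⟩ : TangentBundle I G)) x →
    mfderiv I 𝓘(ℝ, ℝ) (fun y => h.inner y (X y) (Y y)) x u
      = h.inner x (conn X x u) (Y x) + h.inner x (X x) (conn Y x u)

/-- The field `v` has zero divergence with respect to the measure `μ`, in the weak form
`∫ df(v) dμ = 0` for all smooth compactly supported functions `f`. -/
def IsIncompressible [MeasurableSpace G] (μ : Measure G) (v : VectorFields I G) : Prop :=
  ∀ f : G → ℝ, ContMDiff I 𝓘(ℝ, ℝ) ∞ f → HasCompactSupport f →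
    ∫ g, (mfderiv I 𝓘(ℝ, ℝ) f g (v g) : ℝ) ∂μ = 0

/-- `v` is the velocity of a stationary flow of an ideal fluid with pressure `p`: it is smooth,
satisfies the stationary Euler equation `∇_v v = - grad p` (written as
`h(∇_v v, w) = - dp(w)` for all tangent vectors `w`), where `conn` is the Riemannian connection
of `h`, and is incompressible with respect to the measure `μ`. -/
structure IsStationaryIdealFlow [MeasurableSpace G] (μ : Measure G)
    (v : VectorFields I G) (p : G → ℝ) : Prop where
  smooth_velocity : ContMDiff I I.tangent ∞ (fun g => (⟨g, v g⟩ : TangentBundle I G))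
  smooth_pressure : ContMDiff I 𝓘(ℝ, ℝ) ∞ p
  euler : ∀ (g : G) (w : TangentSpace I g),
    h.inner g (conn v g (v g)) w = - (mfderiv I 𝓘(ℝ, ℝ) p g w : ℝ)
  incompressible : IsIncompressible I μ v

end Fluid

section LieGroup

variable [Group G]

/-- The right translate `R_{g*} ξ ∈ T_g G` of `ξ` in the Lie algebra. (Mathlib's
`mulInvariantVectorField ξ g` is the left translate `L_{g*} ξ`.) -/
def rightTranslate (ξ : GroupLieAlgebra I G) (g : G) : TangentSpace I g :=
  mfderiv I I (fun x : G => x * g) 1 ξ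

/-- The vector space of right-invariant covector fields on `G`: those with `R_a^* m = m`
for all `a`. -/
def rightInvariantCovectorFields (G : Type*) [TopologicalSpace G] [ChartedSpace H G] [Group G] :
    Submodule ℝ (CovectorFields I G) where
  carrier := {m | ∀ (a g : G) (u : TangentSpace I g),
    m (g * a) (mfderiv I I (fun x : G => x * a) g u) = m g u}
  add_mem' := by
    intro m n hm hn a g u
    simp only [Pi.add_apply, add_apply, hm a g u, hn a g u]
  zero_mem' := by
    intro a g u
    simp
  smul_mem' := by
    intro c m hm a g u
    simp only [Pi.smul_apply, smul_apply, hm a g u]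

variable [IsManifold I 1 G]
  (h : ContMDiffRiemannianMetric I ∞ E (fun g : G => TangentSpace I g))

/-- The Riemannian metric `h` is left-invariant: all left translations are isometries. -/
def IsLeftInvariantMetric : Prop :=
  ∀ (a g : G) (u w : TangentSpace I g),
    h.inner (a * g) (mfderiv I I (fun x : G => a * x) g u)
      (mfderiv I I (fun x : G => a * x) g w) = h.inner g u w

/-- The momentum in space `m_s = R_g^* m` of the velocity `u ∈ T_g G`, where `m = h_g(u, ·)`. -/
def spatialMomentum (g : G) (u : TangentSpace I g) (ξ : GroupLieAlgebra I G) : ℝ :=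
  h.inner g u (rightTranslate I ξ g)

/-- Near `t₀`, the curve `γ` in `G` with body velocity `Ω` in the Lie algebra is a trajectory of the
geodesic Hamiltonian system of the left-invariant metric `h`, in the left trivialization of
`T^*G`. The inertia operator is `A = h_1`, the momentum in the body is `m_c = A Ω`, and the system
consists of the kinematic equation `L_{γ⁻¹*} γ' = Ω` and of the Euler equation
`m_c' = ad^*_Ω m_c`, that is, `(m_c(ξ))' = m_c([Ω, ξ])` for all `ξ`. -/
def IsGeodesicTrajectoryAt (γ : ℝ → G) (Ω : ℝ → GroupLieAlgebra I G) (t₀ : ℝ) : Prop :=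
  ∀ᶠ t in 𝓝 t₀,
    HasMFDerivAt 𝓘(ℝ, ℝ) I γ t
      ((1 : ℝ →L[ℝ] ℝ).smulRight (mulInvariantVectorField (Ω t) (γ t))) ∧
    ∀ ξ : GroupLieAlgebra I G,
      HasDerivAt (fun s => h.inner (1 : G) (Ω s) ξ) (h.inner (1 : G) (Ω t) ⁅Ω t, ξ⁆) t

/-- `v` is the reduction to `G` of the geodesic system of `h` at the level `m_s` of the Noether
integrals (the momentum in space): the integral curves of `v` are exactly the projections to `G`
of the trajectories whose momentum in space is `m_s`. -/
def IsReducedFieldAt (ms : GroupLieAlgebra I G →L[ℝ] ℝ) (v : VectorFields I G) : Prop :=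
  ∀ (γ : ℝ → G) (t₀ : ℝ), IsMIntegralCurveAt γ v t₀ ↔
    ∃ Ω : ℝ → GroupLieAlgebra I G, IsGeodesicTrajectoryAt I h γ Ω t₀ ∧
      ∀ᶠ t in 𝓝 t₀, ∀ ξ : GroupLieAlgebra I G,
        spatialMomentum I h (γ t) (mulInvariantVectorField (Ω t) (γ t)) ξ = ms ξ

/-- `v` is a reduced field of the geodesic system of `h`, at some value of the momentum. -/
def IsReducedField (v : VectorFields I G) : Prop :=
  ∃ ms : GroupLieAlgebra I G →L[ℝ] ℝ, IsReducedFieldAt I h ms v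

end LieGroup

end Definitions

end IdealFlow

end

/-!
Let `R_ξ`, `L_ξ` be the right- and left-invariant fields with value `ξ` at `1`. A velocity `u` at
`g` has momentum in space `ξ ↦ h_g(u, R_ξ g)`; as the `R_ξ` span every tangent space and `h_g` is
nondegenerate, for each `ms` there is exactly one field, `momentumField h ms`, whose momentum in
space is everywhere `ms`. The reduced fields turn out to be precisely these fields, which makes
linearity and the isomorphism `v ↦ h(v, ·)` with the right-invariant covector fields
(`momentumMap`) immediate, `ms` being the value of the covector field at `1`.

Everything else rests on one identity. Since `L_ξ g = R_{Ad_g ξ} g`, the field `v` at level `ms`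
satisfies `h(v, L_ξ) = ms (Ad_g ξ)`, and the derivative of `Ad` is `ad`, so that
`d(h(v, L_ξ))(L_Ω) = h(v, L_{[Ω, ξ]})` (`mfderiv_adjointRep`, `mfderiv_momentum_adjointRep`).
The derivative of `Ad` is computed in a chart at `1`, where it expresses the symmetry of the
second derivative of the group law (`fderiv_adjoint_eq_lieBracket`).

* Along an integral curve of `v` the identity is the Euler equation `m_c' = ad^*_Ω m_c`, so the
  integral curves of `v` are trajectories (`isReducedFieldAt_momentumField`). Uniqueness of the
  reduced field uses the existence of an integral curve of `v` through every point.
* Taking for `L_Ω` the left-invariant field equal to `v` at the given point, metric compatibility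
  and the Koszul formula for left-invariant fields turn the identity into `h(∇_v v, L_ξ) = 0`
  (`inner_covariantDerivative_momentumField`).
* Right-invariant measures are preserved by right translations, which are the flows of the `L_ξ`;
  hence `∫ dF(L_ξ) dμ = 0`. Writing `v = ∑ vᵢ L_{eᵢ}` in a basis orthogonal for `h_1`, the
  divergence of `v` is `∑ dvᵢ(L_{eᵢ})`, whose terms are multiples of `ms (Ad_g [eᵢ, eᵢ]) = 0`
  (`isIncompressible_momentumField`).
-/

noncomputable section

namespace IdealFlow

/-! ### The adjoint representation and translations -/

section BasePoint

variable {E : Type*} [NormedAddCommGroup E] [NormedSpace ℝ E]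
  {H : Type*} [TopologicalSpace H] {I : ModelWithCorners ℝ E H}
  {M : Type*} [TopologicalSpace M] [ChartedSpace H M]
  {E' : Type*} [NormedAddCommGroup E'] [NormedSpace ℝ E']
  {H' : Type*} [TopologicalSpace H'] {I' : ModelWithCorners ℝ E' H'}
  {M' : Type*} [TopologicalSpace M'] [ChartedSpace H' M']

/-- Change of base point along an equality. As all tangent spaces are definitionally the model
space, this avoids casts between the tangent spaces at, say, `g * 1` and `g`. -/
theorem mfderiv_apply_of_eq (f : M → M') {x y : M} (hxy : x = y) (ζ : E) :
    (mfderiv I I' f x ζ : E') = mfderiv I I' f y ζ := by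
  subst hxy
  rfl

end BasePoint

section LieGroupCalculus

variable {E : Type*} [NormedAddCommGroup E] [NormedSpace ℝ E]
  {H : Type*} [TopologicalSpace H] {I : ModelWithCorners ℝ E H}
  {G : Type*} [TopologicalSpace G] [ChartedSpace H G] [Group G]

variable (I) in
/-- The adjoint representation `Ad g` of a Lie group: the derivative at `1` of the conjugation
`x ↦ g * x * g⁻¹`. The latter fixes `1` only propositionally; the target is the Lie algebra because
all tangent spaces are definitionally the model space. -/
def adjointRep (g : G) : GroupLieAlgebra I G →L[ℝ] GroupLieAlgebra I G :=
  mfderiv I I (fun x : G => g * x * g⁻¹) 1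

theorem adjointRep_one (ξ : GroupLieAlgebra I G) : adjointRep I (1 : G) ξ = ξ := by
  have key : mfderiv I I (fun x : G => 1 * x * 1⁻¹) 1 = ContinuousLinearMap.id ℝ E := by
    have : (fun x : G => 1 * x * 1⁻¹) = id := by ext x; simp
    rw [this]
    exact mfderiv_id
  exact congrArg (fun A => (A : E →L[ℝ] E) ξ) key

variable [LieGroup I ∞ G]

variable (I G) in
theorem lieGroup_minSmoothness : LieGroup I (minSmoothness ℝ 3) G := by
  rw [minSmoothness_of_isRCLikeNormedField]
  exact LieGroup.of_le (n := ∞) ENat.LEInfty.out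

theorem mdifferentiableAt_mul_left (a g : G) : MDifferentiableAt I I (fun x : G => a * x) g :=
  (contMDiff_mul_left (I := I) (n := ∞)).mdifferentiableAt (by simp)

theorem mdifferentiableAt_mul_right (a g : G) : MDifferentiableAt I I (fun x : G => x * a) g :=
  (contMDiff_mul_right (I := I) (n := ∞)).mdifferentiableAt (by simp)

theorem mdifferentiableAt_conj (a g : G) :
    MDifferentiableAt I I (fun x : G => a * x * a⁻¹) g :=
  (mdifferentiableAt_mul_right a⁻¹ (a * g)).comp g (mdifferentiableAt_mul_left a g)

/-- The left translate of `ξ` by `g` is the right translate of `Ad g ξ`. -/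
theorem rightTranslate_adjointRep (g : G) (ξ : GroupLieAlgebra I G) :
    rightTranslate I (adjointRep I g ξ) g = mulInvariantVectorField ξ g := by
  have key : mfderiv I I (fun x : G => g * x) 1
      = (mfderiv I I (fun x : G => x * g) (g * 1 * g⁻¹)).comp
        (mfderiv I I (fun x : G => g * x * g⁻¹) 1) := by
    rw [← mfderiv_comp (I' := I) 1 (mdifferentiableAt_mul_right g _) (mdifferentiableAt_conj g 1)]
    congr 1
    ext x
    simp
  refine (mfderiv_apply_of_eq _ (by simp : g * 1 * g⁻¹ = 1) _).symm.trans ?_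
  exact (congrArg (fun A => (A : E →L[ℝ] E) ξ) key).symm

theorem adjointRep_mul (a g : G) (ξ : GroupLieAlgebra I G) :
    adjointRep I (a * g) ξ = adjointRep I a (adjointRep I g ξ) := by
  have key : mfderiv I I (fun x : G => a * g * x * (a * g)⁻¹) 1
      = (mfderiv I I (fun x : G => a * x * a⁻¹) (g * 1 * g⁻¹)).comp
        (mfderiv I I (fun x : G => g * x * g⁻¹) 1) := by
    rw [← mfderiv_comp (I' := I) 1 (mdifferentiableAt_conj a _) (mdifferentiableAt_conj g 1)]
    congr 1
    ext x
    simp [mul_assoc]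
  exact (congrArg (fun A => (A : E →L[ℝ] E) ξ) key).trans
    (mfderiv_apply_of_eq _ (by simp : g * 1 * g⁻¹ = 1) _)

theorem contMDiff_adjointRep (ξ : GroupLieAlgebra I G) :
    ContMDiff (M' := E) I 𝓘(ℝ, E) ∞ (fun g : G => adjointRep I g ξ) := by
  intro g₀
  have hf : ContMDiff (I.prod I) I ∞ (Function.uncurry fun (g x : G) => g * x * g⁻¹) :=
    (contMDiff_fst.mul contMDiff_snd).mul contMDiff_fst.inv
  have h1 := ContMDiffAt.mfderiv (m := ∞) (n := ∞) (I := I) (I' := I) (x₀ := g₀)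
    (fun (g x : G) => g * x * g⁻¹) (fun _ => 1) hf.contMDiffAt contMDiffAt_const (by simp)
  have h2 := h1.clm_apply (contMDiffAt_const (M' := E) (c := ξ))
  -- All base points involved are equal to `1`, so that the changes of coordinates are trivial.
  have aux : ∀ x y z : G, x = 1 → y = 1 → z = 1 → ∀ ζ : E,
      (tangentBundleCore I G).coordChange (achart H x) (achart H y) z ζ = ζ := by
    rintro _ _ _ rfl rfl rfl ζ
    exact (tangentBundleCore I G).coordChange_self (achart H 1) 1 (mem_chart_source H 1) ζ
  refine h2.congr_of_eventuallyEq (Eventually.of_forall fun g => ?_)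
  have e := inTangentCoordinates_eq (I := I) (I' := I) (fun _ : G => (1 : G))
    (fun g : G => g * 1 * g⁻¹) (fun g => mfderiv I I (fun x : G => g * x * g⁻¹) 1)
    (x₀ := g₀) (x := g) (mem_chart_source H 1) (by simp)
  refine Eq.trans ?_ (congrArg (fun A : E →L[ℝ] E => A ξ) e).symm
  refine Eq.trans ?_ (aux _ _ _ (by simp) (by simp) (by simp) _).symm
  exact (congrArg (mfderiv I I (fun x : G => g * x * g⁻¹) 1 : E →L[ℝ] E)
    (aux _ _ _ rfl rfl rfl ξ)).symm

/-- Left-invariant vector fields on a `C^∞` Lie group are `C^∞`: `L_{g*} ξ` is the image of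
`(0_g, ξ)` under the tangent map of the multiplication. -/
theorem contMDiff_infty_mulInvariantVectorField (ξ : GroupLieAlgebra I G) :
    ContMDiff I I.tangent ∞
      (fun g : G => (⟨g, mulInvariantVectorField ξ g⟩ : TangentBundle I G)) := by
  let fg : G → TangentBundle I G := fun g ↦ TotalSpace.mk' E g 0
  have sfg : ContMDiff I I.tangent ∞ fg := contMDiff_zeroSection _ _
  let fv : G → TangentBundle I G := fun _ ↦ TotalSpace.mk' E 1 ξ
  have sfv : ContMDiff I I.tangent ∞ fv := contMDiff_const
  let F₁ : G → (TangentBundle I G × TangentBundle I G) := fun g ↦ (fg g, fv g)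
  have S₁ : ContMDiff I (I.tangent.prod I.tangent) ∞ F₁ := sfg.prodMk sfv
  let F₂ : (TangentBundle I G × TangentBundle I G) → TangentBundle (I.prod I) (G × G) :=
    (equivTangentBundleProd I G I G).symm
  have S₂ : ContMDiff (I.tangent.prod I.tangent) (I.prod I).tangent ∞ F₂ :=
    contMDiff_equivTangentBundleProd_symm
  let F₃ : TangentBundle (I.prod I) (G × G) → TangentBundle I G :=
    tangentMap (I.prod I) I (fun (p : G × G) ↦ p.1 * p.2)
  have S₃ : ContMDiff (I.prod I).tangent I.tangent ∞ F₃ :=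
    ContMDiff.contMDiff_tangentMap (n := ∞) (contMDiff_mul I ∞) (m := ∞) (by simp)
  let S := (S₃.comp S₂).comp S₁
  convert! S with g
  · simp [F₁, F₂, F₃, fg, fv]
  · simp only [Function.comp_apply, tangentMap, F₃, F₂, F₁, fg, fv]
    rw [mfderiv_prod_eq_add_apply ((contMDiff_mul I ∞).mdifferentiableAt (by simp))]
    refine Eq.trans ?_ (congrArg (· + _) (map_zero _)).symm
    exact (zero_add _).symm

end LieGroupCalculus

/-! ### The derivative of the adjoint representation -/

section MulInChart

variable {E : Type*} [NormedAddCommGroup E] [NormedSpace ℝ E]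
  {H : Type*} [TopologicalSpace H] {I : ModelWithCorners ℝ E H}
  {G : Type*} [TopologicalSpace G] [ChartedSpace H G] [Group G]

variable (I G) in
/-- The multiplication of `G` read in the preferred chart at `1`. -/
def chartMul (p : E × E) : E :=
  extChartAt I (1 : G) ((extChartAt I (1 : G)).symm p.1 * (extChartAt I (1 : G)).symm p.2)

variable [LieGroup I ∞ G]

theorem mdifferentiableAt_extChartAt_one {g : G} (hg : g ∈ (extChartAt I (1 : G)).source) :
    MDifferentiableAt I 𝓘(ℝ, E) (extChartAt I (1 : G)) g :=
  mdifferentiableAt_extChartAt (by simpa using hg)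

/-- The derivative at `1` of `x ↦ φ (g * x)`, where `φ` is the chart at `1`. -/
theorem mfderiv_extChartAt_mul_left {g : G} (hg : g ∈ (extChartAt I (1 : G)).source)
    (ξ : GroupLieAlgebra I G) :
    (mfderiv I 𝓘(ℝ, E) (fun x : G => extChartAt I (1 : G) (g * x)) 1 ξ : E)
      = mfderiv I 𝓘(ℝ, E) (extChartAt I (1 : G)) g (mulInvariantVectorField ξ g) := by
  have key : mfderiv I 𝓘(ℝ, E) (fun x : G => extChartAt I (1 : G) (g * x)) 1
      = (mfderiv I 𝓘(ℝ, E) (extChartAt I (1 : G)) (g * 1)).comp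
        (mfderiv I I (fun x : G => g * x) 1) :=
    mfderiv_comp (I' := I) 1 (mdifferentiableAt_extChartAt_one (by simpa using hg))
      (mdifferentiableAt_mul_left g 1)
  exact (congrArg (fun A => (A : E →L[ℝ] E) ξ) key).trans (mfderiv_apply_of_eq _ (mul_one g) _)

/-- The derivative at `1` of `x ↦ φ (x * g)`, where `φ` is the chart at `1`. -/
theorem mfderiv_extChartAt_mul_right {g : G} (hg : g ∈ (extChartAt I (1 : G)).source)
    (ξ : GroupLieAlgebra I G) :
    (mfderiv I 𝓘(ℝ, E) (fun x : G => extChartAt I (1 : G) (x * g)) 1 ξ : E)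
      = mfderiv I 𝓘(ℝ, E) (extChartAt I (1 : G)) g (rightTranslate I ξ g) := by
  have key : mfderiv I 𝓘(ℝ, E) (fun x : G => extChartAt I (1 : G) (x * g)) 1
      = (mfderiv I 𝓘(ℝ, E) (extChartAt I (1 : G)) (1 * g)).comp
        (mfderiv I I (fun x : G => x * g) 1) :=
    mfderiv_comp (I' := I) 1 (mdifferentiableAt_extChartAt_one (by simpa using hg))
      (mdifferentiableAt_mul_right g 1)
  exact (congrArg (fun A => (A : E →L[ℝ] E) ξ) key).trans (mfderiv_apply_of_eq _ (one_mul g) _)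

variable [I.Boundaryless]

theorem contMDiffAt_extChartAt_symm {u : E} (hu : u ∈ (extChartAt I (1 : G)).target) :
    ContMDiffAt 𝓘(ℝ, E) I ∞ (extChartAt I (1 : G)).symm u :=
  (contMDiffOn_extChartAt_symm (1 : G)).contMDiffAt
    ((isOpen_extChartAt_target (1 : G)).mem_nhds hu)

theorem contDiffAt_chartMul :
    ContDiffAt ℝ ∞ (chartMul I G) (extChartAt I (1 : G) 1, extChartAt I (1 : G) 1) := by
  rw [← contMDiffAt_iff_contDiffAt]
  have h0 := contMDiffAt_extChartAt_symm (I := I) (G := G) (mem_extChartAt_target (I := I) (1 : G))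
  have h1 : ContMDiffAt 𝓘(ℝ, E × E) I ∞ (fun p : E × E => (extChartAt I (1 : G)).symm p.1)
      (extChartAt I (1 : G) 1, extChartAt I (1 : G) 1) :=
    ContMDiffAt.comp (I' := 𝓘(ℝ, E)) _ h0 contDiff_fst.contMDiff.contMDiffAt
  have h2 : ContMDiffAt 𝓘(ℝ, E × E) I ∞ (fun p : E × E => (extChartAt I (1 : G)).symm p.2)
      (extChartAt I (1 : G) 1, extChartAt I (1 : G) 1) :=
    ContMDiffAt.comp (I' := 𝓘(ℝ, E)) _ h0 contDiff_snd.contMDiff.contMDiffAt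
  have h3 := h1.mul h2
  refine ContMDiffAt.comp (I' := I) _ ?_ h3
  exact contMDiffAt_extChartAt' (by simp)

/-- The partial derivative of the multiplication with respect to the second factor at `1` is the
chart representation of the left-invariant fields. -/
theorem fderiv_chartMul_snd (ξ : GroupLieAlgebra I G) :
    ∀ᶠ u in 𝓝 (extChartAt I (1 : G) 1),
      fderiv ℝ (chartMul I G) (u, extChartAt I (1 : G) 1)
          (0, mfderiv I 𝓘(ℝ, E) (extChartAt I (1 : G)) 1 ξ)
        = mfderiv I 𝓘(ℝ, E) (extChartAt I (1 : G)) ((extChartAt I (1 : G)).symm u)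
            (mulInvariantVectorField ξ ((extChartAt I (1 : G)).symm u)) := by
  set φ := extChartAt I (1 : G) with hφ
  have hd : ∀ᶠ p in 𝓝 (φ 1, φ 1), DifferentiableAt ℝ (chartMul I G) p :=
    (((contDiffAt_chartMul (I := I) (G := G)).of_le (m := 1) (by simp)).eventually
      (by simp)).mono fun p hp => hp.differentiableAt (by simp)
  have hd' : ∀ᶠ u in 𝓝 (φ 1), DifferentiableAt ℝ (chartMul I G) (u, φ 1) :=
    (Continuous.prodMk_left (φ 1)).tendsto (φ 1) hd
  filter_upwards [hd', extChartAt_target_mem_nhds (I := I) (1 : G)] with u hu hut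
  rw [← mfderiv_extChartAt_mul_left (φ.map_target hut) ξ]
  have h1 := HasFDerivAt.comp (g := chartMul I G) (f := fun w => (u, w)) (φ 1) hu.hasFDerivAt
    (hasFDerivAt_prodMk_right u (φ 1))
  have h2 := HasMFDerivAt.comp (1 : G) h1.hasMFDerivAt
    (mdifferentiableAt_extChartAt_one (I := I) (mem_extChartAt_source (1 : G))).hasMFDerivAt
  have h3 : (fun x : G => φ (φ.symm u * x)) =ᶠ[𝓝 1] chartMul I G ∘ (fun x : G => (u, φ x)) := by
    filter_upwards [extChartAt_source_mem_nhds (I := I) (1 : G)] with x hx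
    simp only [chartMul, Function.comp_apply, ← hφ]
    rw [φ.left_inv hx]
  exact (congrArg (fun A => (A : E →L[ℝ] E) ξ) (h2.congr_of_eventuallyEq h3).mfderiv).symm

/-- The partial derivative of the multiplication with respect to the first factor at `1` is the
chart representation of the right-invariant fields. -/
theorem fderiv_chartMul_fst :
    ∀ᶠ u in 𝓝 (extChartAt I (1 : G) 1), ∀ ξ : GroupLieAlgebra I G,
      fderiv ℝ (chartMul I G) (extChartAt I (1 : G) 1, u)
          (mfderiv I 𝓘(ℝ, E) (extChartAt I (1 : G)) 1 ξ, 0)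
        = mfderiv I 𝓘(ℝ, E) (extChartAt I (1 : G)) ((extChartAt I (1 : G)).symm u)
            (rightTranslate I ξ ((extChartAt I (1 : G)).symm u)) := by
  set φ := extChartAt I (1 : G) with hφ
  have hd : ∀ᶠ p in 𝓝 (φ 1, φ 1), DifferentiableAt ℝ (chartMul I G) p :=
    (((contDiffAt_chartMul (I := I) (G := G)).of_le (m := 1) (by simp)).eventually
      (by simp)).mono fun p hp => hp.differentiableAt (by simp)
  have hd' : ∀ᶠ u in 𝓝 (φ 1), DifferentiableAt ℝ (chartMul I G) (φ 1, u) :=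
    (Continuous.prodMk_right (φ 1)).tendsto (φ 1) hd
  filter_upwards [hd', extChartAt_target_mem_nhds (I := I) (1 : G)] with u hu hut ξ
  rw [← mfderiv_extChartAt_mul_right (φ.map_target hut) ξ]
  have h1 := HasFDerivAt.comp (g := chartMul I G) (f := fun w => (w, u)) (φ 1) hu.hasFDerivAt
    (hasFDerivAt_prodMk_left (φ 1) u)
  have h2 := HasMFDerivAt.comp (1 : G) h1.hasMFDerivAt
    (mdifferentiableAt_extChartAt_one (I := I) (mem_extChartAt_source (1 : G))).hasMFDerivAt
  have h3 : (fun x : G => φ (x * φ.symm u)) =ᶠ[𝓝 1] chartMul I G ∘ (fun x : G => (φ x, u)) := by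
    filter_upwards [extChartAt_source_mem_nhds (I := I) (1 : G)] with x hx
    simp only [chartMul, Function.comp_apply, ← hφ]
    rw [φ.left_inv hx]
  exact (congrArg (fun A => (A : E →L[ℝ] E) ξ) (h2.congr_of_eventuallyEq h3).mfderiv).symm

/-- The Lie bracket in terms of the mixed second derivatives of the multiplication. -/
theorem mfderiv_extChartAt_bracket (Ω ξ : GroupLieAlgebra I G) :
    (mfderiv I 𝓘(ℝ, E) (extChartAt I (1 : G)) 1 ⁅Ω, ξ⁆ : E)
      = VectorField.lieBracket ℝ
        (fun u => fderiv ℝ (chartMul I G) (u, extChartAt I (1 : G) 1)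
          (0, mfderiv I 𝓘(ℝ, E) (extChartAt I (1 : G)) 1 Ω))
        (fun u => fderiv ℝ (chartMul I G) (u, extChartAt I (1 : G) 1)
          (0, mfderiv I 𝓘(ℝ, E) (extChartAt I (1 : G)) 1 ξ)) (extChartAt I (1 : G) 1) := by
  have pull : ∀ ζ : GroupLieAlgebra I G,
      VectorField.mpullbackWithin 𝓘(ℝ, E) I (extChartAt I (1 : G)).symm
        (mulInvariantVectorField ζ) (Set.range I) =ᶠ[𝓝 (extChartAt I (1 : G) 1)]
      (fun u => fderiv ℝ (chartMul I G) (u, extChartAt I (1 : G) 1)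
          (0, mfderiv I 𝓘(ℝ, E) (extChartAt I (1 : G)) 1 ζ)) := by
    intro ζ
    filter_upwards [fderiv_chartMul_snd ζ, extChartAt_target_mem_nhds (I := I) (1 : G)]
      with u hu hut
    refine Eq.trans ?_ hu.symm
    refine (isInvertible_mfderivWithin_extChartAt_symm hut).inverse_apply_eq.2 ?_
    exact (congrArg (fun A => A (mulInvariantVectorField ζ ((extChartAt I (1 : G)).symm u)))
      (mfderivWithin_extChartAt_symm_comp_mfderiv_extChartAt hut)).symm
  rw [GroupLieAlgebra.bracket_def, ← VectorField.mlieBracketWithin_univ,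
    VectorField.mlieBracketWithin_apply]
  have hr : (extChartAt I (1 : G)).symm ⁻¹' Set.univ ∩ Set.range I = Set.univ := by
    simp [I.range_eq_univ]
  have hb : VectorField.lieBracketWithin ℝ
      (VectorField.mpullbackWithin 𝓘(ℝ, E) I (extChartAt I (1 : G)).symm
        (mulInvariantVectorField Ω) (Set.range I) : E → E)
      (VectorField.mpullbackWithin 𝓘(ℝ, E) I (extChartAt I (1 : G)).symm
        (mulInvariantVectorField ξ) (Set.range I) : E → E)
      ((extChartAt I (1 : G)).symm ⁻¹' Set.univ ∩ Set.range I) (extChartAt I (1 : G) 1)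
      = VectorField.lieBracket ℝ
        (VectorField.mpullbackWithin 𝓘(ℝ, E) I (extChartAt I (1 : G)).symm
          (mulInvariantVectorField Ω) (Set.range I) : E → E)
        (VectorField.mpullbackWithin 𝓘(ℝ, E) I (extChartAt I (1 : G)).symm
          (mulInvariantVectorField ξ) (Set.range I) : E → E) (extChartAt I (1 : G) 1) := by
    rw [hr]
    exact congrFun VectorField.lieBracketWithin_univ _
  refine Eq.trans ?_ (hb.trans ((pull Ω).lieBracket_vectorField_eq (pull ξ)))
  exact ((isInvertible_mfderiv_extChartAt
    (mem_extChartAt_source (I := I) (1 : G))).inverse_apply_eq.1 rfl).symm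

end MulInChart

section LocalGroupLaw

variable {E : Type*} [NormedAddCommGroup E] [NormedSpace ℝ E]

/-- The infinitesimal form of `Ad`, for a local group law `K` on a vector space with unit `e`.
The hypothesis `ha` says that `a u` is the adjoint action of `u` on `η`: its right translate by `u`
is the left translate of `η`. Differentiating it at `e`, the claim is the symmetry of the
second derivative of `K`. -/
theorem fderiv_adjoint_eq_lieBracket {K : E × E → E} {e : E} (hK : ContDiffAt ℝ 2 K (e, e))
    (hl : ∀ᶠ u in 𝓝 e, K (u, e) = u) (hr : ∀ᶠ u in 𝓝 e, K (e, u) = u)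
    {a : E → E} (had : DifferentiableAt ℝ a e)
    (ha : ∀ᶠ u in 𝓝 e, fderiv ℝ K (e, u) (a u, 0) = fderiv ℝ K (u, e) (0, a e)) (v : E) :
    fderiv ℝ a e v = VectorField.lieBracket ℝ
      (fun u => fderiv ℝ K (u, e) (0, v)) (fun u => fderiv ℝ K (u, e) (0, a e)) e := by
  have hd : HasFDerivAt K (fderiv ℝ K (e, e)) (e, e) :=
    (hK.differentiableAt (by norm_num)).hasFDerivAt
  have hF : HasFDerivAt (fderiv ℝ K) (fderiv ℝ (fderiv ℝ K) (e, e)) (e, e) :=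
    ((hK.fderiv_right (m := 1) (by norm_num)).differentiableAt (by norm_num)).hasFDerivAt
  have hl' : ∀ y : E, fderiv ℝ K (e, e) (y, 0) = y := fun y =>
    congrArg (fun A : E →L[ℝ] E => A y)
      ((HasFDerivAt.comp (g := K) (f := fun w => (w, e)) e hd
        (hasFDerivAt_prodMk_left e e)).unique ((hasFDerivAt_id e).congr_of_eventuallyEq hl))
  have hr' : ∀ y : E, fderiv ℝ K (e, e) (0, y) = y := fun y =>
    congrArg (fun A : E →L[ℝ] E => A y)
      ((HasFDerivAt.comp (g := K) (f := fun w => (e, w)) e hd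
        (hasFDerivAt_prodMk_right e e)).unique ((hasFDerivAt_id e).congr_of_eventuallyEq hr))
  have hsym : ∀ x y, fderiv ℝ (fderiv ℝ K) (e, e) x y = fderiv ℝ (fderiv ℝ K) (e, e) y x :=
    hK.isSymmSndFDerivAt (by simp)
  have hleft : ∀ y x : E, fderiv ℝ (fun u => fderiv ℝ K (u, e) (0, y)) e x
      = fderiv ℝ (fderiv ℝ K) (e, e) (x, 0) (0, y) := fun y x => by
    have h1 := (HasFDerivAt.comp (g := fderiv ℝ K) (f := fun w => (w, e)) e hF
      (hasFDerivAt_prodMk_left e e)).clm_apply (hasFDerivAt_const ((0, y) : E × E) e)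
    have h2 := congrArg (fun A : E →L[ℝ] E => A x) h1.fderiv
    simpa using h2
  have hright : fderiv ℝ (fun u => fderiv ℝ K (e, u) (a u, 0)) e v
      = fderiv ℝ a e v + fderiv ℝ (fderiv ℝ K) (e, e) (0, v) (a e, 0) := by
    have h1 := (HasFDerivAt.comp (g := fderiv ℝ K) (f := fun w => (e, w)) e hF
      (hasFDerivAt_prodMk_right e e)).clm_apply
        (had.hasFDerivAt.prodMk (hasFDerivAt_const (0 : E) e))
    have h2 := congrArg (fun A : E →L[ℝ] E => A v) h1.fderiv
    simpa [hl'] using h2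
  have hEq := congrArg (fun A : E →L[ℝ] E => A v) (Filter.EventuallyEq.fderiv_eq ha)
  simp only [hright, hleft] at hEq
  rw [VectorField.lieBracket_eq]
  simp only [hleft, hr']
  rw [← hEq, hsym (a e, 0)]
  abel

end LocalGroupLaw

section Adjoint

variable {E : Type*} [NormedAddCommGroup E] [NormedSpace ℝ E]
  {H : Type*} [TopologicalSpace H] {I : ModelWithCorners ℝ E H}
  {G : Type*} [TopologicalSpace G] [ChartedSpace H G] [Group G]
  [LieGroup I ∞ G]

theorem hasMFDerivAt_adjointRep (g : G) (ξ : GroupLieAlgebra I G) :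
    HasMFDerivAt (M' := E) I 𝓘(ℝ, E) (fun x : G => adjointRep I x ξ) g
      (mfderiv (M' := E) I 𝓘(ℝ, E) (fun x : G => adjointRep I x ξ) g) :=
  ((contMDiff_adjointRep ξ).mdifferentiableAt (by simp)).hasMFDerivAt

variable [I.Boundaryless]

/-- The derivative of `Ad` at `1` is `ad`. -/
theorem mfderiv_adjointRep_one (Ω ξ : GroupLieAlgebra I G) :
    mfderiv (M' := E) I 𝓘(ℝ, E) (fun g : G => adjointRep I g ξ) 1 Ω
      = (⁅Ω, ξ⁆ : GroupLieAlgebra I G) := by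
  set φ := extChartAt I (1 : G) with hφ
  let A : E →L[ℝ] E := mfderiv I 𝓘(ℝ, E) φ 1
  have hA : Function.Injective A :=
    (isInvertible_mfderiv_extChartAt (mem_extChartAt_source (I := I) (1 : G))).injective
  have h1 : φ.symm (φ 1) = 1 := φ.left_inv (mem_extChartAt_source 1)
  let b : E → E := fun u => adjointRep I (φ.symm u) ξ
  have hb : DifferentiableAt ℝ b (φ 1) := by
    have : MDifferentiableAt (M' := E) 𝓘(ℝ, E) 𝓘(ℝ, E) b (φ 1) :=
      (((contMDiff_adjointRep ξ).contMDiffAt).comp (φ 1)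
        (contMDiffAt_extChartAt_symm (mem_extChartAt_target (1 : G)))).mdifferentiableAt (by simp)
    exact this.differentiableAt
  have hb1 : b (φ 1) = ξ := by
    change adjointRep I (φ.symm (φ 1)) ξ = ξ
    rw [h1, adjointRep_one]
  have hcomp : mfderiv (M' := E) I 𝓘(ℝ, E) (fun g : G => adjointRep I g ξ) 1 Ω
      = fderiv ℝ b (φ 1) (A Ω) := by
    have h2 := HasMFDerivAt.comp (1 : G) hb.hasFDerivAt.hasMFDerivAt
      (mdifferentiableAt_extChartAt_one (I := I) (mem_extChartAt_source (1 : G))).hasMFDerivAt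
    have h3 : (fun g : G => (adjointRep I g ξ : E)) =ᶠ[𝓝 1] b ∘ φ := by
      filter_upwards [extChartAt_source_mem_nhds (I := I) (1 : G)] with x hx
      simp only [b, Function.comp_apply]
      rw [φ.left_inv hx]
    exact congrArg (fun B => (B : E →L[ℝ] E) Ω) (h2.congr_of_eventuallyEq h3).mfderiv
  apply hA
  refine Eq.trans ?_ (mfderiv_extChartAt_bracket Ω ξ).symm
  have main := fderiv_adjoint_eq_lieBracket (K := chartMul I G) (e := φ 1) (a := fun u => A (b u))
    (contDiffAt_chartMul.of_le (by exact_mod_cast ENat.LEInfty.out)) ?_ ?_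
    (A.differentiableAt.comp _ hb) ?_ (A Ω)
  · have h4 := HasFDerivAt.comp (φ 1) A.hasFDerivAt hb.hasFDerivAt
    rw [show (fun u => A (b u)) = A ∘ b from rfl, h4.fderiv] at main
    rw [hcomp]
    refine Eq.trans main ?_
    simp only [hb1]
    rfl
  · filter_upwards [extChartAt_target_mem_nhds (I := I) (1 : G)] with u hu
    simp only [chartMul, ← hφ]
    rw [h1, mul_one, φ.right_inv hu]
  · filter_upwards [extChartAt_target_mem_nhds (I := I) (1 : G)] with u hu
    simp only [chartMul, ← hφ]
    rw [h1, one_mul, φ.right_inv hu]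
  · filter_upwards [fderiv_chartMul_snd (I := I) (G := G) ξ,
      fderiv_chartMul_fst (I := I) (G := G)] with u h2 h3
    rw [hb1]
    refine (h3 (adjointRep I (φ.symm u) ξ)).trans (Eq.trans ?_ h2.symm)
    rw [rightTranslate_adjointRep]

/-- The derivative of `Ad` along left-invariant fields, obtained from the one at `1` by
`Ad (g * x) = Ad g ∘ Ad x`. -/
theorem mfderiv_adjointRep (g : G) (Ω ξ : GroupLieAlgebra I G) :
    mfderiv (M' := E) I 𝓘(ℝ, E) (fun x : G => adjointRep I x ξ) g (mulInvariantVectorField Ω g)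
      = (adjointRep I g ⁅Ω, ξ⁆ : E) := by
  let B : E →L[ℝ] E := adjointRep I g
  have h1 := HasMFDerivAt.comp (1 : G) B.hasFDerivAt.hasMFDerivAt
    (hasMFDerivAt_adjointRep (1 : G) ξ)
  have h2 : (fun x : G => (adjointRep I (g * x) ξ : E))
      = B ∘ (fun x : G => adjointRep I x ξ) := by
    ext x
    exact adjointRep_mul g x ξ
  have h3 : HasMFDerivAt (M' := E) I 𝓘(ℝ, E) (fun x : G => adjointRep I x ξ) (g * 1)
      (mfderiv (M' := E) I 𝓘(ℝ, E) (fun x : G => adjointRep I x ξ) (g * 1)) :=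
    hasMFDerivAt_adjointRep _ ξ
  have h4 := HasMFDerivAt.comp (1 : G) h3 (mdifferentiableAt_mul_left (I := I) g 1).hasMFDerivAt
  rw [← h2] at h1
  refine (mfderiv_apply_of_eq _ (mul_one g) _).symm.trans ?_
  refine (congrArg (fun B => (B : E →L[ℝ] E) Ω) (hasMFDerivAt_unique h4 h1)).trans ?_
  exact congrArg B (mfderiv_adjointRep_one Ω ξ)

end Adjoint

/-! ### Left-invariant fields and right-invariant measures -/

section IntegrationByParts

variable {E : Type*} [NormedAddCommGroup E] [NormedSpace ℝ E]
  {H : Type*} [TopologicalSpace H] {I : ModelWithCorners ℝ E H}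
  {G : Type*} [TopologicalSpace G] [ChartedSpace H G]

theorem hasCompactSupport_mfderiv_apply {F : G → ℝ} (hF : HasCompactSupport F)
    (X : VectorFields I G) :
    HasCompactSupport fun g => (mfderiv I 𝓘(ℝ, ℝ) F g (X g) : ℝ) := by
  refine hF.of_isClosed_subset (isClosed_tsupport _) ?_
  refine closure_minimal (fun g hg => ?_) (isClosed_tsupport F)
  by_contra hn
  have h1 : F =ᶠ[𝓝 g] fun _ => (0 : ℝ) := notMem_tsupport_iff_eventuallyEq.1 hn
  apply hg
  have h2 : mfderiv I 𝓘(ℝ, ℝ) F g = 0 := by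
    rw [h1.mfderiv_eq, mfderiv_const]
    rfl
  exact congrArg (fun A => A (X g)) h2

/-- The chain rule for a function along a curve with a given velocity. -/
theorem hasDerivAt_comp_curve {F : G → ℝ} {c : ℝ → G} {t : ℝ} {u : TangentSpace I (c t)}
    (hF : MDifferentiableAt I 𝓘(ℝ, ℝ) F (c t))
    (hc : HasMFDerivAt 𝓘(ℝ, ℝ) I c t ((1 : ℝ →L[ℝ] ℝ).smulRight u)) :
    HasDerivAt (fun s => F (c s)) (mfderiv I 𝓘(ℝ, ℝ) F (c t) u : ℝ) t := by
  let D : ℝ →L[ℝ] ℝ := (mfderiv I 𝓘(ℝ, ℝ) F (c t) : E →L[ℝ] ℝ).comp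
    ((1 : ℝ →L[ℝ] ℝ).smulRight (u : E))
  have h1 : HasFDerivAt (fun s => F (c s)) D t :=
    (HasMFDerivAt.comp t hF.hasMFDerivAt hc).hasFDerivAt
  refine h1.hasDerivAt.congr_deriv ?_
  exact congrArg (mfderiv I 𝓘(ℝ, ℝ) F (c t) : E →L[ℝ] ℝ) (one_smul ℝ (u : E))

variable [Group G] [LieGroup I ∞ G]

theorem continuous_mfderiv_mulInvariantVectorField {F : G → ℝ} (hF : ContMDiff I 𝓘(ℝ, ℝ) ∞ F)
    (ξ : GroupLieAlgebra I G) :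
    Continuous fun g => (mfderiv I 𝓘(ℝ, ℝ) F g (mulInvariantVectorField ξ g) : ℝ) := by
  have h1 := (hF.continuous_tangentMap (by simp)).comp
    (contMDiff_infty_mulInvariantVectorField ξ).continuous
  exact continuous_snd.comp ((tangentBundleModelSpaceHomeomorph 𝓘(ℝ, ℝ)).continuous.comp h1)

/-- Left translates of an integral curve of a left-invariant field are integral curves. -/
theorem hasDerivAt_comp_mul_integralCurve {F : G → ℝ} (hF : ContMDiff I 𝓘(ℝ, ℝ) ∞ F)
    {ξ : GroupLieAlgebra I G} {c : ℝ → G} {t : ℝ}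
    (hc : HasMFDerivAt 𝓘(ℝ, ℝ) I c t
      ((1 : ℝ →L[ℝ] ℝ).smulRight (mulInvariantVectorField ξ (c t)))) (g : G) :
    HasDerivAt (fun s => F (g * c s))
      (mfderiv I 𝓘(ℝ, ℝ) F (g * c t) (mulInvariantVectorField ξ (g * c t)) : ℝ) t := by
  have h1 := HasMFDerivAt.comp t (mdifferentiableAt_mul_left (I := I) g (c t)).hasMFDerivAt hc
  have key : mfderiv I I (fun x : G => g * c t * x) 1
      = (mfderiv I I (fun x : G => g * x) (c t * 1)).comp
        (mfderiv I I (fun x : G => c t * x) 1) := by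
    rw [← mfderiv_comp (I' := I) 1 (mdifferentiableAt_mul_left g _)
      (mdifferentiableAt_mul_left (c t) 1)]
    congr 1
    ext x
    simp [mul_assoc]
  have h4 : (mulInvariantVectorField ξ (g * c t) : E)
      = mfderiv I I (fun x : G => g * x) (c t) (mulInvariantVectorField ξ (c t)) :=
    (congrArg (fun A => (A : E →L[ℝ] E) ξ) key).trans (mfderiv_apply_of_eq _ (mul_one _) _)
  refine hasDerivAt_comp_curve (c := fun s => g * c s) (hF.mdifferentiableAt (by simp)) ?_
  refine h1.congr_mfderiv (ContinuousLinearMap.ext fun r => ?_)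
  rw [h4]
  exact (mfderiv I I (fun x : G => g * x) (c t) : E →L[ℝ] E).map_smul (r : ℝ)
    (mulInvariantVectorField ξ (c t) : E)

variable [MeasurableSpace G] [BorelSpace G] (μ : Measure G) [IsFiniteMeasureOnCompacts μ]

theorem integrable_mfderiv_mulInvariantVectorField {F : G → ℝ} (hF : ContMDiff I 𝓘(ℝ, ℝ) ∞ F)
    (hc : HasCompactSupport F) (ξ : GroupLieAlgebra I G) :
    Integrable (fun g => (mfderiv I 𝓘(ℝ, ℝ) F g (mulInvariantVectorField ξ g) : ℝ)) μ :=
  (continuous_mfderiv_mulInvariantVectorField hF ξ).integrable_of_hasCompactSupport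
    (hasCompactSupport_mfderiv_apply hc _)

open scoped Pointwise in
/-- Left-invariant vector fields are divergence free with respect to right-invariant measures,
as their flows are right translations. -/
theorem integral_mfderiv_mulInvariantVectorField [CompleteSpace E] [I.Boundaryless]
    [μ.IsMulRightInvariant] {F : G → ℝ}
    (hF : ContMDiff I 𝓘(ℝ, ℝ) ∞ F) (hc : HasCompactSupport F) (ξ : GroupLieAlgebra I G) :
    ∫ g, (mfderiv I 𝓘(ℝ, ℝ) F g (mulInvariantVectorField ξ g) : ℝ) ∂μ = 0 := by
  have : IsTopologicalGroup G := topologicalGroup_of_lieGroup I ∞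
  set P : G → ℝ := fun g => (mfderiv I 𝓘(ℝ, ℝ) F g (mulInvariantVectorField ξ g) : ℝ) with hP
  have hPcont : Continuous P := continuous_mfderiv_mulInvariantVectorField hF ξ
  have hPsupp : HasCompactSupport P := hasCompactSupport_mfderiv_apply hc _
  obtain ⟨C, hC⟩ := hPsupp.exists_bound_of_continuous hPcont
  obtain ⟨c, hc0, hcurve⟩ := exists_isMIntegralCurveAt_of_contMDiffAt_boundaryless (I := I)
    (v := mulInvariantVectorField ξ) 0 (x₀ := (1 : G))
    ((contMDiff_infty_mulInvariantVectorField ξ).contMDiffAt.of_le (by simp))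
  obtain ⟨ε, hε, hball⟩ := Metric.eventually_nhds_iff_ball.1 hcurve
  have hsub : Metric.closedBall (0 : ℝ) (ε / 2) ⊆ Metric.ball 0 ε :=
    Metric.closedBall_subset_ball (by linarith)
  have hK : IsCompact (c '' Metric.closedBall (0 : ℝ) (ε / 2)) :=
    (isCompact_closedBall 0 (ε / 2)).image_of_continuousOn fun t ht =>
      (hball t (hsub ht)).continuousAt.continuousWithinAt
  -- For small `t` all the functions `g ↦ P (g * c t)` vanish outside this compact set.
  set K : Set G := closure (tsupport P * (c '' Metric.closedBall (0 : ℝ) (ε / 2))⁻¹) with hKdef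
  have hKc : IsCompact K := (IsCompact.mul hPsupp hK.inv).closure
  have hPK : ∀ t ∈ Metric.ball (0 : ℝ) (ε / 2), ∀ g, g ∉ K → P (g * c t) = 0 := by
    intro t ht g hg
    by_contra hne
    refine hg (subset_closure ⟨g * c t, subset_tsupport _ hne, (c t)⁻¹, ?_, by simp⟩)
    exact Set.inv_mem_inv.2 ⟨t, Metric.ball_subset_closedBall ht, rfl⟩
  have hFint : ∀ t, Integrable (fun g => F (g * c t)) μ := fun t =>
    (hF.continuous.comp (continuous_mul_const (c t))).integrable_of_hasCompactSupport
      (hc.comp_homeomorph (Homeomorph.mulRight (c t)))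
  have main := hasDerivAt_integral_of_dominated_loc_of_deriv_le (μ := μ) (x₀ := (0 : ℝ))
    (F := fun t g => F (g * c t)) (F' := fun t g => P (g * c t)) (bound := K.indicator fun _ => C)
    (Metric.ball_mem_nhds 0 (half_pos hε))
    (Eventually.of_forall fun t => (hFint t).aestronglyMeasurable) (hFint 0)
    (hPcont.comp (continuous_mul_const (c 0))).aestronglyMeasurable
    (Eventually.of_forall fun g t ht => ?_)
    ((integrableOn_const hKc.measure_lt_top.ne).integrable_indicator
      isClosed_closure.measurableSet)
    (Eventually.of_forall fun g t ht => hasDerivAt_comp_mul_integralCurve hF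
      (hball t (hsub (Metric.ball_subset_closedBall ht))) g)
  -- By right invariance of `μ` the integral being differentiated does not depend on `t`.
  · have hconst : (fun t => ∫ g, F (g * c t) ∂μ) = fun _ => ∫ g, F g ∂μ := by
      ext t
      exact integral_mul_right_eq_self F (c t)
    have h1 := main.2
    rw [hconst] at h1
    simpa [hc0] using h1.unique (hasDerivAt_const _ _)
  · by_cases hg : g ∈ K
    · simpa [hg] using hC _
    · simp [hg, hPK t ht g hg]

end IntegrationByParts

/-! ### Fields of constant momentum in space -/

section ReducedFields

variable {E : Type*} [NormedAddCommGroup E] [NormedSpace ℝ E]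
  {H : Type*} [TopologicalSpace H] {I : ModelWithCorners ℝ E H}
  {G : Type*} [TopologicalSpace G] [ChartedSpace H G]

section Metric

variable [IsManifold I 1 G]
  {h : ContMDiffRiemannianMetric I ∞ E (fun g : G => TangentSpace I g)}

theorem eq_zero_of_inner_self {g : G} {u : TangentSpace I g} (hu : h.inner g u u = 0) :
    u = 0 := by
  by_contra hne
  exact (h.pos g u hne).ne' hu

variable [Group G]

theorem exists_inertia_orthogonal_basis [FiniteDimensional ℝ E]
    (h : ContMDiffRiemannianMetric I ∞ E (fun g : G => TangentSpace I g)) :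
    ∃ e : Module.Basis (Fin (Module.finrank ℝ E)) ℝ (GroupLieAlgebra I G),
      ∀ i j, i ≠ j → h.inner 1 (e i) (e j) = 0 := by
  let A : E →L[ℝ] E →L[ℝ] ℝ := h.inner 1
  let B : LinearMap.BilinForm ℝ E := LinearMap.mk₂ ℝ (fun x y => A x y)
    (by simp) (by simp) (by simp) (by simp)
  have hB : LinearMap.IsSymm B := ⟨fun x y => h.symm 1 x y⟩
  let : Invertible (2 : ℝ) := invertibleOfNonzero two_ne_zero
  obtain ⟨e, he⟩ := LinearMap.BilinForm.exists_orthogonal_basis (B := B) hB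
  exact ⟨e, fun i j hij => he hij⟩

end Metric

variable [Group G]

theorem apply_rightTranslate_of_mem {m : CovectorFields I G}
    (hm : m ∈ rightInvariantCovectorFields I G) (g : G) (ξ : GroupLieAlgebra I G) :
    m g (rightTranslate I ξ g) = m 1 ξ := by
  have aux : ∀ y : G, y = g → ∀ u : E, (m y : E →L[ℝ] ℝ) u = (m g : E →L[ℝ] ℝ) u := by
    rintro _ rfl u
    rfl
  exact (aux _ (one_mul g) _).symm.trans (hm g 1 ξ)

variable [LieGroup I ∞ G]

theorem mfderiv_mul_right_rightTranslate (a g : G) (ξ : GroupLieAlgebra I G) :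
    mfderiv I I (fun x : G => x * a) g (rightTranslate I ξ g) = rightTranslate I ξ (g * a) := by
  have key : mfderiv I I (fun x : G => x * (g * a)) 1
      = (mfderiv I I (fun x : G => x * a) (1 * g)).comp (mfderiv I I (fun x : G => x * g) 1) := by
    rw [← mfderiv_comp (I' := I) 1 (mdifferentiableAt_mul_right a _)
      (mdifferentiableAt_mul_right g 1)]
    congr 1
    ext x
    simp [mul_assoc]
  exact ((congrArg (fun A => (A : E →L[ℝ] E) ξ) key).trans
    (mfderiv_apply_of_eq _ (one_mul g) _)).symm

theorem contMDiff_momentum_adjointRep (ms : GroupLieAlgebra I G →L[ℝ] ℝ)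
    (ξ : GroupLieAlgebra I G) :
    ContMDiff I 𝓘(ℝ, ℝ) ∞ (fun g : G => ms (adjointRep I g ξ)) := by
  let m : E →L[ℝ] ℝ := ms
  exact m.contDiff.contMDiff.comp (contMDiff_adjointRep ξ)

/-- The momentum in the body varies along the left-invariant fields by the coadjoint action. -/
theorem mfderiv_momentum_adjointRep [I.Boundaryless] (ms : GroupLieAlgebra I G →L[ℝ] ℝ) (g : G)
    (Ω ξ : GroupLieAlgebra I G) :
    (mfderiv I 𝓘(ℝ, ℝ) (fun x : G => ms (adjointRep I x ξ)) g (mulInvariantVectorField Ω g) : ℝ)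
      = ms (adjointRep I g ⁅Ω, ξ⁆) := by
  let m : E →L[ℝ] ℝ := ms
  have h1 := HasMFDerivAt.comp g m.hasFDerivAt.hasMFDerivAt (hasMFDerivAt_adjointRep g ξ)
  have h2 : HasMFDerivAt I 𝓘(ℝ, ℝ) (fun x : G => ms (adjointRep I x ξ)) g _ := h1
  refine (congrArg (fun A => (A : E →L[ℝ] ℝ) (mulInvariantVectorField Ω g)) h2.mfderiv).trans ?_
  exact congrArg m (mfderiv_adjointRep g Ω ξ)

theorem mdifferentiableAt_momentum_adjointRep (ms : GroupLieAlgebra I G →L[ℝ] ℝ) (g : G)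
    (ξ : GroupLieAlgebra I G) :
    MDifferentiableAt I 𝓘(ℝ, ℝ) (fun x : G => ms (adjointRep I x ξ)) g :=
  (contMDiff_momentum_adjointRep ms ξ).mdifferentiableAt (by simp)

variable {h : ContMDiffRiemannianMetric I ∞ E (fun g : G => TangentSpace I g)}

theorem inner_mulInvariantVectorField (hh : IsLeftInvariantMetric I h) (g : G)
    (ξ η : GroupLieAlgebra I G) :
    h.inner g (mulInvariantVectorField ξ g) (mulInvariantVectorField η g) = h.inner 1 ξ η := by
  have aux : ∀ y : G, y = g → ∀ u w : E,
      (h.inner y : E →L[ℝ] E →L[ℝ] ℝ) u w = (h.inner g : E →L[ℝ] E →L[ℝ] ℝ) u w := by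
    rintro _ rfl u w
    rfl
  exact (aux _ (mul_one g) _ _).symm.trans (hh g 1 ξ η)

variable [FiniteDimensional ℝ E]

theorem mulInvariantVectorField_bijective (hh : IsLeftInvariantMetric I h) (g : G) :
    Function.Bijective (fun ξ : GroupLieAlgebra I G => mulInvariantVectorField ξ g) := by
  let A : E →L[ℝ] E := mfderiv I I (fun x : G => g * x) 1
  have hinj : Function.Injective A := by
    refine (injective_iff_map_eq_zero A).2 fun ξ hξ => ?_
    refine eq_zero_of_inner_self (h := h) (g := (1 : G)) ?_
    have h0 : mulInvariantVectorField (I := I) (G := G) ξ g = 0 := hξ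
    refine (inner_mulInvariantVectorField hh g ξ ξ).symm.trans ?_
    rw [h0, map_zero]
  exact ⟨hinj, LinearMap.injective_iff_surjective (f := A.toLinearMap).1 hinj⟩

theorem rightTranslate_bijective (hh : IsLeftInvariantMetric I h) (g : G) :
    Function.Bijective (fun ξ : GroupLieAlgebra I G => rightTranslate I ξ g) := by
  let A : E →L[ℝ] E := mfderiv I I (fun x : G => x * g) 1
  have hsurj : Function.Surjective A := by
    intro u
    obtain ⟨ξ, hξ⟩ := (mulInvariantVectorField_bijective hh g).2 u
    exact ⟨adjointRep I g ξ, (rightTranslate_adjointRep g ξ).trans hξ⟩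
  exact ⟨LinearMap.injective_iff_surjective (f := A.toLinearMap).2 hsurj, hsurj⟩

variable (h) in
/-- A basis of the Lie algebra that is orthogonal for the inertia operator `h_1`. -/
def inertiaBasis : Module.Basis (Fin (Module.finrank ℝ E)) ℝ (GroupLieAlgebra I G) :=
  (exists_inertia_orthogonal_basis h).choose

theorem inner_inertiaBasis_of_ne {i j : Fin (Module.finrank ℝ E)} (hij : i ≠ j) :
    h.inner 1 (inertiaBasis h i) (inertiaBasis h j) = 0 :=
  (exists_inertia_orthogonal_basis h).choose_spec i j hij

theorem inner_inertiaBasis_self_ne_zero (i : Fin (Module.finrank ℝ E)) :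
    h.inner 1 (inertiaBasis h i) (inertiaBasis h i) ≠ 0 := fun h0 =>
  (inertiaBasis h).ne_zero i (eq_zero_of_inner_self h0)

variable (h) in
/-- The `i`-th coordinate, in the inertia basis, of the body velocity at `g` of a motion with
momentum in space `ms`. -/
def bodyCoord (ms : GroupLieAlgebra I G →L[ℝ] ℝ) (i : Fin (Module.finrank ℝ E)) (g : G) : ℝ :=
  (h.inner 1 (inertiaBasis h i) (inertiaBasis h i))⁻¹ * ms (adjointRep I g (inertiaBasis h i))

variable (h) in
/-- The body velocity at `g` of a motion with momentum in space `ms`: the vector `Ω` with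
`h_1(Ω, ·) = Ad_g^* ms`. -/
def bodyVelocity (ms : GroupLieAlgebra I G →L[ℝ] ℝ) (g : G) : GroupLieAlgebra I G :=
  ∑ i, bodyCoord h ms i g • inertiaBasis h i

variable (h) in
/-- The vector field on `G` whose momentum in space is everywhere `ms`. -/
def momentumField (ms : GroupLieAlgebra I G →L[ℝ] ℝ) : VectorFields I G :=
  fun g => mulInvariantVectorField (bodyVelocity h ms g) g

theorem inner_bodyVelocity (ms : GroupLieAlgebra I G →L[ℝ] ℝ) (g : G) (ξ : GroupLieAlgebra I G) :
    h.inner 1 (bodyVelocity h ms g) ξ = ms (adjointRep I g ξ) := by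
  let A : GroupLieAlgebra I G →ₗ[ℝ] ℝ := (h.inner 1 (bodyVelocity h ms g)).toLinearMap
  let B : GroupLieAlgebra I G →ₗ[ℝ] ℝ := (ms.comp (adjointRep I g)).toLinearMap
  suffices A = B from LinearMap.congr_fun this ξ
  refine (inertiaBasis h).ext fun j => ?_
  change h.inner 1 (bodyVelocity h ms g) (inertiaBasis h j) = ms (adjointRep I g (inertiaBasis h j))
  rw [bodyVelocity, map_sum, sum_apply, Finset.sum_eq_single j]
  · rw [map_smul, smul_apply, bodyCoord, smul_eq_mul]
    field_simp [inner_inertiaBasis_self_ne_zero (h := h) j]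
  · intro i _ hij
    rw [map_smul, smul_apply, inner_inertiaBasis_of_ne hij, smul_zero]
  · simp

theorem inner_momentumField_left (hh : IsLeftInvariantMetric I h)
    (ms : GroupLieAlgebra I G →L[ℝ] ℝ) (g : G) (ξ : GroupLieAlgebra I G) :
    h.inner g (momentumField h ms g) (mulInvariantVectorField ξ g) = ms (adjointRep I g ξ) := by
  rw [momentumField, inner_mulInvariantVectorField hh, inner_bodyVelocity]

theorem inner_momentumField_right (hh : IsLeftInvariantMetric I h)
    (ms : GroupLieAlgebra I G →L[ℝ] ℝ) (g : G) (ξ : GroupLieAlgebra I G) :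
    h.inner g (momentumField h ms g) (rightTranslate I ξ g) = ms ξ := by
  obtain ⟨η, hη⟩ := (mulInvariantVectorField_bijective hh g).2 (rightTranslate I ξ g)
  have h1 : adjointRep I g η = ξ :=
    (rightTranslate_bijective hh g).1 ((rightTranslate_adjointRep g η).trans hη)
  rw [← h1, rightTranslate_adjointRep, inner_momentumField_left hh]

/-- A velocity is determined by its momentum in space. -/
theorem eq_of_inner_rightTranslate_eq (hh : IsLeftInvariantMetric I h) {g : G}
    {u w : TangentSpace I g}
    (huw : ∀ ξ, h.inner g u (rightTranslate I ξ g) = h.inner g w (rightTranslate I ξ g)) :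
    u = w := by
  obtain ⟨ξ, hξ⟩ := (rightTranslate_bijective hh g).2 (u - w)
  rw [← sub_eq_zero]
  refine eq_zero_of_inner_self (h := h) ?_
  have h1 := huw ξ
  rw [show rightTranslate I ξ g = u - w from hξ] at h1
  have h2 : h.inner g (u - w) = h.inner g u - h.inner g w := map_sub _ _ _
  rw [h2, sub_apply, h1, sub_self]

theorem eq_momentumField (hh : IsLeftInvariantMetric I h) {ms : GroupLieAlgebra I G →L[ℝ] ℝ}
    {g : G} {u : TangentSpace I g} (hu : ∀ ξ, h.inner g u (rightTranslate I ξ g) = ms ξ) :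
    u = momentumField h ms g :=
  eq_of_inner_rightTranslate_eq hh fun ξ => by rw [hu, inner_momentumField_right hh]

theorem contMDiff_bodyCoord (ms : GroupLieAlgebra I G →L[ℝ] ℝ) (i : Fin (Module.finrank ℝ E)) :
    ContMDiff I 𝓘(ℝ, ℝ) ∞ (bodyCoord h ms i) :=
  contMDiff_const.mul (contMDiff_momentum_adjointRep ms _)

theorem momentumField_eq_sum (ms : GroupLieAlgebra I G →L[ℝ] ℝ) (g : G) :
    momentumField h ms g
      = ∑ i, bodyCoord h ms i g • mulInvariantVectorField (inertiaBasis h i) g := by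
  simp only [momentumField, bodyVelocity, mulInvariantVectorField, map_sum, map_smul]
  rfl

theorem contMDiff_momentumField (ms : GroupLieAlgebra I G →L[ℝ] ℝ) :
    ContMDiff I I.tangent ∞ (fun g => (⟨g, momentumField h ms g⟩ : TangentBundle I G)) := by
  simp only [momentumField_eq_sum]
  refine ContMDiff.sum_section fun i _ => ?_
  exact (contMDiff_bodyCoord ms i).smul_section (contMDiff_infty_mulInvariantVectorField _)

/-- For a curve `γ` with constant momentum in space `ms` the Euler equation holds automatically:
its momentum in the body is `Ad_γ^* ms`, whose derivative is given by
`mfderiv_momentum_adjointRep`. -/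
theorem isReducedFieldAt_momentumField [I.Boundaryless] (hh : IsLeftInvariantMetric I h)
    (ms : GroupLieAlgebra I G →L[ℝ] ℝ) : IsReducedFieldAt I h ms (momentumField h ms) := by
  intro γ t₀
  constructor
  · intro hγ
    refine ⟨fun t => bodyVelocity h ms (γ t), ?_, ?_⟩
    · filter_upwards [hγ] with t ht
      refine ⟨ht, fun ξ => ?_⟩
      simp only [inner_bodyVelocity]
      exact (hasDerivAt_comp_curve (mdifferentiableAt_momentum_adjointRep ms (γ t) ξ) ht).congr_deriv
        (mfderiv_momentum_adjointRep ms (γ t) (bodyVelocity h ms (γ t)) ξ)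
    · exact Eventually.of_forall fun t ξ => inner_momentumField_right hh ms (γ t) ξ
  · rintro ⟨Ω, hΩ, hm⟩
    filter_upwards [hΩ, hm] with t h1 h2
    rw [← eq_momentumField hh h2]
    exact h1.1

/-- The reduced field at a given level is unique, because an integral curve of `momentumField`
passes through every point. -/
theorem IsReducedFieldAt.eq_momentumField [I.Boundaryless] (hh : IsLeftInvariantMetric I h)
    {ms : GroupLieAlgebra I G →L[ℝ] ℝ} {v : VectorFields I G} (hv : IsReducedFieldAt I h ms v) :
    v = momentumField h ms := by
  have : CompleteSpace E := FiniteDimensional.complete ℝ E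
  ext g
  obtain ⟨γ, rfl, hγ⟩ := exists_isMIntegralCurveAt_of_contMDiffAt_boundaryless (I := I)
    (v := momentumField h ms) 0 (x₀ := g)
    ((contMDiff_momentumField ms).contMDiffAt.of_le (by simp))
  have hγ' : IsMIntegralCurveAt γ v 0 :=
    (hv γ 0).2 ((isReducedFieldAt_momentumField hh ms γ 0).1 hγ)
  have h1 := hasMFDerivAt_unique hγ'.self_of_nhds hγ.self_of_nhds
  have h2 := congrArg (fun A : ℝ →L[ℝ] E => A 1) h1
  exact (one_smul ℝ (v (γ 0) : E)).symm.trans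
    (h2.trans (one_smul ℝ (momentumField h ms (γ 0) : E)))

variable (h) in
/-- The vector fields whose momentum in space is constant on `G`. -/
def constantMomentumFields : Submodule ℝ (VectorFields I G) where
  carrier := {v | ∃ ms : GroupLieAlgebra I G →L[ℝ] ℝ, ∀ g ξ,
    h.inner g (v g) (rightTranslate I ξ g) = ms ξ}
  add_mem' := by
    rintro v w ⟨m, hm⟩ ⟨n, hn⟩
    refine ⟨m + n, fun g ξ => ?_⟩
    rw [Pi.add_apply, map_add, add_apply, hm, hn,
      add_apply]
  zero_mem' := ⟨0, fun g ξ => by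
    rw [Pi.zero_apply, map_zero]
    rfl⟩
  smul_mem' := by
    rintro c v ⟨m, hm⟩
    refine ⟨c • m, fun g ξ => ?_⟩
    rw [Pi.smul_apply, map_smul, smul_apply, hm,
      smul_apply]

theorem momentumField_mem (hh : IsLeftInvariantMetric I h) (ms : GroupLieAlgebra I G →L[ℝ] ℝ) :
    momentumField h ms ∈ constantMomentumFields h :=
  ⟨ms, inner_momentumField_right hh ms⟩

theorem exists_eq_momentumField (hh : IsLeftInvariantMetric I h) {v : VectorFields I G}
    (hv : v ∈ constantMomentumFields h) : ∃ ms, v = momentumField h ms := by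
  obtain ⟨ms, hms⟩ := hv
  exact ⟨ms, funext fun g => eq_momentumField hh (hms g)⟩

theorem mem_constantMomentumFields_iff [I.Boundaryless] (hh : IsLeftInvariantMetric I h)
    (v : VectorFields I G) : v ∈ constantMomentumFields h ↔ IsReducedField I h v := by
  constructor
  · intro hv
    obtain ⟨ms, rfl⟩ := exists_eq_momentumField hh hv
    exact ⟨ms, isReducedFieldAt_momentumField hh ms⟩
  · rintro ⟨ms, hms⟩
    rw [hms.eq_momentumField hh]
    exact momentumField_mem hh ms

/-- Reduced fields are geodesic: `∇_v v = 0`. Evaluated against left-invariant fields, this is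
compatibility of `∇` with the metric together with the Koszul formula for left-invariant fields. -/
theorem inner_covariantDerivative_momentumField [I.Boundaryless] (hh : IsLeftInvariantMetric I h)
    {conn : CovariantDerivative I E (fun g : G => TangentSpace I g)}
    (hconn : IsLeviCivita I h conn) (ms : GroupLieAlgebra I G →L[ℝ] ℝ) (g : G)
    (w : TangentSpace I g) :
    h.inner g (conn (momentumField h ms) g (momentumField h ms g)) w = 0 := by
  have : LieGroup I (minSmoothness ℝ 3) G := lieGroup_minSmoothness I G
  have : CompleteSpace E := FiniteDimensional.complete ℝ E
  obtain ⟨ξ, rfl⟩ := (mulInvariantVectorField_bijective hh g).2 w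
  set v := momentumField h ms with hv
  -- `L` is the left-invariant field that agrees with `v` at `g`.
  set Ω := bodyVelocity h ms g
  set L : VectorFields I G := mulInvariantVectorField Ω with hL
  set X : VectorFields I G := mulInvariantVectorField ξ with hX
  have hvL : v g = L g := rfl
  have hdv := (contMDiff_momentumField (h := h) ms).mdifferentiableAt (x := g) (by simp)
  have hdL := (contMDiff_infty_mulInvariantVectorField (I := I) (G := G) Ω).mdifferentiableAt
    (x := g) (by simp)
  have hdX := (contMDiff_infty_mulInvariantVectorField (I := I) (G := G) ξ).mdifferentiableAt
    (x := g) (by simp)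
  have e1 := hconn.metric v X g (v g) hdv hdX
  have e1' : (mfderiv I 𝓘(ℝ, ℝ) (fun y => h.inner y (v y) (X y)) g (v g) : ℝ)
      = h.inner g (L g) (mulInvariantVectorField ⁅Ω, ξ⁆ g) := by
    have : (fun y => h.inner y (v y) (X y)) = fun y => ms (adjointRep I y ξ) :=
      funext fun y => inner_momentumField_left hh ms y ξ
    rw [this]
    refine (mfderiv_momentum_adjointRep ms g Ω ξ).trans ?_
    exact (inner_momentumField_left hh ms g _).symm
  have e2 := hconn.torsion_free L X g hdL hdX
  have e2' : VectorField.mlieBracket I L X g = mulInvariantVectorField ⁅Ω, ξ⁆ g :=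
    (congrFun (mulInvariantVector_mlieBracket Ω ξ) g).symm
  have e3 := hconn.metric L L g (X g) hdL hdL
  have e3' : (mfderiv I 𝓘(ℝ, ℝ) (fun y => h.inner y (L y) (L y)) g (X g) : ℝ) = 0 := by
    have : (fun y => h.inner y (L y) (L y)) = fun _ => h.inner 1 Ω Ω :=
      funext fun y => inner_mulInvariantVectorField hh y Ω Ω
    rw [this, mfderiv_const]
    rfl
  have e4 := congrArg (h.inner g (L g)) (e2.trans e2')
  rw [map_sub] at e4
  rw [h.symm g (conn L g (X g)) (L g)] at e3
  rw [hvL] at e1 e1' ⊢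
  have e5 : h.inner g (conn v g (L g)) (X g) + h.inner g (L g) (conn X g (L g))
      = h.inner g (L g) (mulInvariantVectorField ⁅Ω, ξ⁆ g) := e1.symm.trans e1'
  have e6 : h.inner g (L g) (conn L g (X g)) + h.inner g (L g) (conn L g (X g)) = 0 :=
    e3.symm.trans e3'
  change h.inner g (conn v g (L g)) (X g) = 0
  have algebra : ∀ a p q r : ℝ, a + p = r → p - q = r → q + q = 0 → a = 0 := by
    intros
    linarith
  exact algebra _ _ _ _ e5 e4 e6

/-- With `v = ∑ vᵢ Lᵢ` and left-invariant `Lᵢ`, the divergence of `v` is `∑ dvᵢ(Lᵢ)`, as the `Lᵢ`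
have none. Each term vanishes: it is the momentum in the body paired with a bracket `[eᵢ, eᵢ]`. -/
theorem isIncompressible_momentumField [I.Boundaryless] [MeasurableSpace G] [BorelSpace G]
    (μ : Measure G) [IsFiniteMeasureOnCompacts μ] [μ.IsMulRightInvariant]
    (ms : GroupLieAlgebra I G →L[ℝ] ℝ) :
    IsIncompressible I μ (momentumField h ms) := by
  have : CompleteSpace E := FiniteDimensional.complete ℝ E
  intro f hf hfc
  have hsmooth : ∀ i, ContMDiff I 𝓘(ℝ, ℝ) ∞ (fun g => bodyCoord h ms i g * f g) := fun i =>
    (contMDiff_bodyCoord ms i).mul hf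
  have hsupp : ∀ i, HasCompactSupport (fun g => bodyCoord h ms i g * f g) := fun i =>
    hfc.mul_left
  -- The `i`-th coordinate of `v` is constant along the `i`-th left-invariant field.
  have hzero : ∀ i g, (mfderiv I 𝓘(ℝ, ℝ) (bodyCoord h ms i) g
      (mulInvariantVectorField (inertiaBasis h i) g) : ℝ) = 0 := by
    intro i g
    have h2 := mfderiv_momentum_adjointRep ms g (inertiaBasis h i) (inertiaBasis h i)
    rw [GroupLieAlgebra.bracket_def, VectorField.mlieBracket_self, Pi.zero_apply, map_zero,
      map_zero] at h2
    have h3 := (mdifferentiableAt_momentum_adjointRep ms g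
      (inertiaBasis h i)).hasMFDerivAt.const_smul (h.inner 1 (inertiaBasis h i) (inertiaBasis h i))⁻¹
    refine (congrArg (fun A => (A : E →L[ℝ] ℝ) (mulInvariantVectorField (inertiaBasis h i) g))
      h3.mfderiv).trans ?_
    exact (congrArg (fun r : ℝ => (h.inner 1 (inertiaBasis h i) (inertiaBasis h i))⁻¹ * r)
      (h2 : _ = (0 : ℝ))).trans (mul_zero _)
  have hpoint : ∀ g, (mfderiv I 𝓘(ℝ, ℝ) f g (momentumField h ms g) : ℝ)
      = ∑ i, (mfderiv I 𝓘(ℝ, ℝ) (fun g => bodyCoord h ms i g * f g) g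
          (mulInvariantVectorField (inertiaBasis h i) g) : ℝ) := by
    intro g
    rw [momentumField_eq_sum]
    refine (map_sum (mfderiv I 𝓘(ℝ, ℝ) f g) _ _).trans (Finset.sum_congr rfl fun i _ => ?_)
    have h4 := ((contMDiff_bodyCoord (h := h) ms i).mdifferentiableAt (x := g)
      (by simp)).hasMFDerivAt.mul (hf.mdifferentiableAt (x := g) (by simp)).hasMFDerivAt
    refine Eq.trans ?_ (congrArg (fun A => (A : E →L[ℝ] ℝ)
      (mulInvariantVectorField (inertiaBasis h i) g)) h4.mfderiv).symm
    let Df : E →L[ℝ] ℝ := mfderiv I 𝓘(ℝ, ℝ) f g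
    let Dc : E →L[ℝ] ℝ := mfderiv I 𝓘(ℝ, ℝ) (bodyCoord h ms i) g
    let u : E := mulInvariantVectorField (inertiaBasis h i) g
    have h5 : Df (bodyCoord h ms i g • u) = bodyCoord h ms i g * Df u + f g * Dc u := by
      rw [show Dc u = 0 from hzero i g, map_smul, smul_eq_mul, mul_zero, add_zero]
    exact h5
  simp only [hpoint]
  rw [integral_finsetSum _ fun i _ =>
    integrable_mfderiv_mulInvariantVectorField μ (hsmooth i) (hsupp i) _]
  exact Finset.sum_eq_zero fun i _ =>
    integral_mfderiv_mulInvariantVectorField μ (hsmooth i) (hsupp i) _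

theorem inner_mem_rightInvariantCovectorFields (hh : IsLeftInvariantMetric I h)
    {v : VectorFields I G} (hv : v ∈ constantMomentumFields h) :
    (fun g => h.inner g (v g)) ∈ rightInvariantCovectorFields I G := by
  obtain ⟨ms, hms⟩ := hv
  intro a g u
  obtain ⟨ξ, rfl⟩ := (rightTranslate_bijective hh g).2 u
  simp only
  rw [mfderiv_mul_right_rightTranslate, hms, hms]

/-- The linear map sending a reduced field to its momentum covector field. -/
def momentumMap (hh : IsLeftInvariantMetric I h) :
    constantMomentumFields h →ₗ[ℝ] rightInvariantCovectorFields I G where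
  toFun v := ⟨fun g => h.inner g (v.1 g), inner_mem_rightInvariantCovectorFields hh v.2⟩
  map_add' v w := Subtype.ext <| funext fun g => map_add (h.inner g) (v.1 g) (w.1 g)
  map_smul' c v := Subtype.ext <| funext fun g => map_smul (h.inner g) c (v.1 g)

theorem momentumMap_bijective (hh : IsLeftInvariantMetric I h) :
    Function.Bijective (momentumMap hh) := by
  constructor
  · intro v w hvw
    refine Subtype.ext <| funext fun g => eq_of_inner_rightTranslate_eq hh fun ξ => ?_
    exact congrArg (fun A : E →L[ℝ] ℝ => A (rightTranslate I ξ g))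
      (congrFun (congrArg Subtype.val hvw) g)
  · intro m
    refine ⟨⟨momentumField h (m.1 1), momentumField_mem hh _⟩, Subtype.ext <| funext fun g =>
      ContinuousLinearMap.ext fun w => ?_⟩
    obtain ⟨ξ, hξ⟩ := (rightTranslate_bijective hh g).2 w
    rw [← hξ]
    exact (inner_momentumField_right hh _ g ξ).trans (apply_rightTranslate_of_mem m.2 g ξ).symm

end ReducedFields

end IdealFlow

end

theorem proposition3p1
    {E : Type*} [NormedAddCommGroup E] [NormedSpace ℝ E] [FiniteDimensional ℝ E]
    {H : Type*} [TopologicalSpace H] (I : ModelWithCorners ℝ E H)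
    {G : Type*} [TopologicalSpace G] [ChartedSpace H G] [Group G]
    [LieGroup I ∞ G] [I.Boundaryless]
    [MeasurableSpace G] [BorelSpace G]
    (h : ContMDiffRiemannianMetric I ∞ E (fun g : G => TangentSpace I g))
    (hh : IdealFlow.IsLeftInvariantMetric I h) :
    ∃ S : Submodule ℝ (IdealFlow.VectorFields I G),
      (∀ v : IdealFlow.VectorFields I G, v ∈ S ↔ IdealFlow.IsReducedField I h v) ∧
      (∀ (conn : CovariantDerivative I E (fun g : G => TangentSpace I g)) (μ : Measure G)
          [IsFiniteMeasureOnCompacts μ] [μ.IsOpenPosMeasure] [μ.IsMulRightInvariant],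
        IdealFlow.IsLeviCivita I h conn →
        ∀ v ∈ S, ∃ c : ℝ, IdealFlow.IsStationaryIdealFlow I h conn μ v (fun _ => c)) ∧
      ∃ Φ : S ≃ₗ[ℝ] IdealFlow.rightInvariantCovectorFields I G,
        ∀ (v : S) (g : G) (w : TangentSpace I g),
          (Φ v : IdealFlow.CovectorFields I G) g w
            = h.inner g ((v : IdealFlow.VectorFields I G) g) w := by
  refine ⟨IdealFlow.constantMomentumFields h, IdealFlow.mem_constantMomentumFields_iff hh, ?_,
    LinearEquiv.ofBijective (IdealFlow.momentumMap hh) (IdealFlow.momentumMap_bijective hh),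
    fun v g w => rfl⟩
  intro conn μ _ _ _ hconn v hv
  obtain ⟨ms, rfl⟩ := IdealFlow.exists_eq_momentumField hh hv
  refine ⟨0, IdealFlow.contMDiff_momentumField ms, contMDiff_const, fun g w => ?_,
    IdealFlow.isIncompressible_momentumField μ ms⟩
  rw [IdealFlow.inner_covariantDerivative_momentumField hh hconn, mfderiv_const]
  exact neg_zero.symm
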